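/- Let $W=(W_t)_{t\ge 0}$ be a standard real-valued Brownian motion, and let $\Psi_2(x)=e^{x^2}-1$. For $h\in(0,1)$ and $f:[0,1]\to\mathbb{R}$ put $$\omega_{\Psi_2}(h,f)=\inf\Big\{K>0:\ \int_0^{1-h}\Psi_2\Big(\frac{|f(x+h)-f(x)|}{K}\Big)\,dx\le 1\Big\},$$ and let $$Y_h=\max\Big[0,\ \frac{\omega_{\Psi_2}(h,W)}{\sqrt h}-\sqrt{\tfrac83}\Big],$$ where $\omega_{\Psi_2}(h,W)$ is evaluated on the path of $W$ restricted to $[0,1]$. Then, as $h\downarrow 0$: (a) for every real $s<\frac14$, $Y_h=\mathcal{O}_P(h^{s})$; that is, for every $\varepsilon>0$ there is a finite constant $C$ such that $P(Y_h>C h^{s})\le\varepsilon$ for all sufficiently small $h>0$; (b) for every real $s^*<\frac1{10}$, $Y_h=\mathcal{O}(h^{s^*})$ almost surely; that is, almost surely there is a finite (random) constant $C$ such that $Y_h\le C h^{s^*}$ for all sufficiently small $h>0$. -/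

import Mathlib

open MeasureTheory ProbabilityTheory Filter Topology
open scoped NNReal ENNReal

namespace OrliczBrownian

/-- The sub-Gaussian Young function `Ψ₂(x) = exp(x²) - 1`. -/
noncomputable def Psi2 (x : ℝ) : ℝ := Real.exp (x ^ 2) - 1

/-- The Orlicz modulus of continuity
`ω_Ψ(h, f) = inf {K > 0 : ∫₀^{1-h} Ψ(|f(x+h) - f(x)| / K) dx ≤ 1}`,
as an extended nonnegative number (it is `∞` if there is no such `K`).
Only the values of `f` on `[0,1]` enter when `0 < h < 1`. -/
noncomputable def orliczModulus (Ψ : ℝ → ℝ) (h : ℝ) (f : ℝ → ℝ) : ℝ≥0∞ :=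
  ⨅ (K : ℝ) (_ : 0 < K)
    (_ : ∫⁻ x in Set.Icc (0 : ℝ) (1 - h), ENNReal.ofReal (Ψ (|f (x + h) - f x| / K)) ≤ 1),
    ENNReal.ofReal K

/-- The random variable `max (0, ω_{Ψ₂}(h, W) / √h - √(8/3))`.
Subtraction in `ℝ≥0∞` is truncated at zero, that is, `a - b` is the positive part of the
difference. -/
noncomputable def modulusExcess {Ω : Type*} (W : ℝ≥0 → Ω → ℝ) (h : ℝ) (ω : Ω) : ℝ≥0∞ :=
  orliczModulus Psi2 h (fun t => W t.toNNReal ω) / ENNReal.ofReal (√h)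
    - ENNReal.ofReal (√(8 / 3))

/-- `Y_h = O_P(a_h)` as `h ↓ 0`: for every `ε > 0` there is a finite constant `C` with
`P(Y_h > C a_h) ≤ ε` for all sufficiently small `h > 0`. -/
def IsBigOInProbability {Ω : Type*} [MeasurableSpace Ω] (P : Measure Ω)
    (Y : ℝ → Ω → ℝ≥0∞) (a : ℝ → ℝ) : Prop :=
  ∀ ε : ℝ, 0 < ε → ∃ C : ℝ≥0, ∀ᶠ h in 𝓝[>] (0 : ℝ),
    P {ω | (C : ℝ≥0∞) * ENNReal.ofReal (a h) < Y h ω} ≤ ENNReal.ofReal ε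

/-- `Y_h = O(a_h)` as `h ↓ 0`, almost surely: for almost every `ω` there is a finite `C`
(depending on `ω`) with `Y_h(ω) ≤ C a_h` for all sufficiently small `h > 0`. -/
def IsBigOAlmostSurely {Ω : Type*} [MeasurableSpace Ω] (P : Measure Ω)
    (Y : ℝ → Ω → ℝ≥0∞) (a : ℝ → ℝ) : Prop :=
  ∀ᵐ ω ∂P, ∃ C : ℝ≥0, ∀ᶠ h in 𝓝[>] (0 : ℝ),
    Y h ω ≤ (C : ℝ≥0∞) * ENNReal.ofReal (a h)

end OrliczBrownian

/-!
Write `N_h(x) = (W(x+h) - W(x)) / √h`, a standard Gaussian variable for each `x`, and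
`K = √(8/3) + δ`. Since `E exp(a N²) = (1 - 2a)^(-1/2)`, the mean of `exp(N_h(x)² / K²)` is `2` for
`δ = 0` and at most `2 - δ/4` for `0 ≤ δ ≤ 1` (`inv_sqrt_one_sub_le`). The modulus is at most
`K √h` as soon as `∫₀¹ exp(N_h(x)² / K²) dx ≤ 2`, so only upward deviations of size `δ/4` of this
average from its mean matter.

The integrand has moments of every order `p < 4/3`, but not of order `4/3`, uniformly in `K`, and
its values at points at distance at least `h` are independent. Truncating at a level `M`, with
Markov's inequality for the part above `M` and Chebyshev's inequality for the part below, bounds the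
probability of such a deviation (`measure_lintegral_gt_le`); for `δ = h^s` the best level is
`M = h^(s-1)`, which gives `O(h^(p-1-sp))` (`exists_measure_one_lt_lintegral_Psi2_le`). For
`s < 1/4` the exponent is positive when `p` is close to `4/3`, which is the statement in
probability.

For the almost sure statement, Borel-Cantelli applies along `h_n = n⁻⁵`, because
`5 (p - 1 - sp) > 1` is possible exactly when `s < 1/10`. Between consecutive `h_n` the increments
change by at most `C (h_n - h_{n+1})^γ` for any `γ < 1/2`, by the Hölder continuity of Brownian
paths (`ae_exists_holder_bound`, by dyadic chaining); relative to `√h` this is of order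
`n^(5/2-6γ)`, and `γ = (5/2 + 5s)/6 < 1/2` makes it `O(h^s)`. Convexity of `Ψ₂` turns the
uniform bound on the change into a bound on the modulus (`lintegral_Psi2_le_one_of_abs_le`).

Measurability is dealt with by passing to a version of the process all of whose paths are
continuous and which agrees with `W` at all times simultaneously, almost surely
(`exists_continuous_version`).
-/

namespace OrliczBrownian

/-! ### Averages of random fields with finite range dependence -/

/-- Second moment of the average of a bounded random field: when the values at `x` and `y` are
orthogonal unless `y ∈ S x`, only pairs with `y ∈ S x` contribute to the double integral, and each
of them contributes at most `V` since `2ab ≤ a² + b²`. -/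
theorem integral_sq_integral_le {X Ω : Type*} [MeasurableSpace X] [MeasurableSpace Ω]
    {μ : Measure X} [IsProbabilityMeasure μ] {P : Measure Ω} [IsProbabilityMeasure P]
    {Z : X → Ω → ℝ} (hZ : Measurable (Function.uncurry Z)) {B V δ : ℝ}
    (hB : ∀ x ω, |Z x ω| ≤ B) (hV0 : 0 ≤ V) (hV : ∀ x, ∫ ω, Z x ω ^ 2 ∂P ≤ V)
    {S : X → Set X} (hS : ∀ x, MeasurableSet (S x)) (hSδ : ∀ x, μ.real (S x) ≤ δ)
    (h0 : ∀ᵐ x ∂μ, ∀ᵐ y ∂μ, y ∉ S x → ∫ ω, Z x ω * Z y ω ∂P = 0) :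
    ∫ ω, (∫ x, Z x ω ∂μ) ^ 2 ∂P ≤ δ * V := by
  have hB2 : ∀ x y ω, |Z x ω * Z y ω| ≤ B * B := fun x y ω => by
    rw [abs_mul]
    exact mul_le_mul (hB x ω) (hB y ω) (abs_nonneg _) ((abs_nonneg _).trans (hB x ω))
  have hZx : ∀ x, Measurable (Z x) := fun x => hZ.comp measurable_prodMk_left
  have hm : Measurable (fun q : Ω × (X × X) => Z q.2.1 q.1 * Z q.2.2 q.1) :=
    (hZ.comp (f := fun q : Ω × (X × X) => (q.2.1, q.1)) (by fun_prop)).mul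
      (hZ.comp (f := fun q : Ω × (X × X) => (q.2.2, q.1)) (by fun_prop))
  have hint : Integrable (fun q : Ω × (X × X) => Z q.2.1 q.1 * Z q.2.2 q.1)
      (P.prod (μ.prod μ)) :=
    Integrable.of_bound hm.aestronglyMeasurable (B * B)
      (Eventually.of_forall fun q => hB2 _ _ _)
  have hsq : ∀ ω, (∫ x, Z x ω ∂μ) ^ 2 = ∫ z : X × X, Z z.1 ω * Z z.2 ω ∂(μ.prod μ) :=
    fun ω => by rw [integral_prod_mul (fun x => Z x ω) (fun x => Z x ω), sq]
  have hsq_int : ∀ x, Integrable (fun ω => Z x ω ^ 2) P := fun x =>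
    Integrable.of_bound ((hZx x).pow_const 2).aestronglyMeasurable (B * B)
      (Eventually.of_forall fun ω => by simpa [sq] using hB2 x x ω)
  have hc : ∀ x y, ∫ ω, Z x ω * Z y ω ∂P ≤ V := fun x y => by
    calc ∫ ω, Z x ω * Z y ω ∂P ≤ ∫ ω, (Z x ω ^ 2 / 2 + Z y ω ^ 2 / 2) ∂P := by
          refine integral_mono (Integrable.of_bound
            ((hZx x).mul (hZx y)).aestronglyMeasurable (B * B)
              (Eventually.of_forall fun ω => hB2 x y ω))
            (((hsq_int x).div_const 2).add ((hsq_int y).div_const 2)) fun ω => ?_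
          have := sq_nonneg (Z x ω - Z y ω)
          simp only
          nlinarith
      _ = (∫ ω, Z x ω ^ 2 ∂P) / 2 + (∫ ω, Z y ω ^ 2 ∂P) / 2 := by
          rw [integral_add ((hsq_int x).div_const 2) ((hsq_int y).div_const 2),
            integral_div, integral_div]
      _ ≤ V := by linarith [hV x, hV y]
  simp_rw [hsq]
  rw [integral_integral_swap (f := fun ω (z : X × X) => Z z.1 ω * Z z.2 ω) hint,
    integral_prod _ hint.integral_prod_right]
  have hprod := (hint.integral_prod_right (f := fun q : Ω × (X × X) => Z q.2.1 q.1 * Z q.2.2 q.1))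
  calc ∫ x, ∫ y, ∫ ω, Z x ω * Z y ω ∂P ∂μ ∂μ ≤ ∫ _, δ * V ∂μ := by
        refine integral_mono_ae hprod.integral_prod_left (integrable_const _) ?_
        filter_upwards [h0, hprod.prod_right_ae] with x hx hxi
        calc ∫ y, ∫ ω, Z x ω * Z y ω ∂P ∂μ ≤ ∫ y, (S x).indicator (fun _ => V) y ∂μ := by
              refine integral_mono_ae hxi ((integrable_const V).indicator (hS x)) ?_
              filter_upwards [hx] with y hy
              by_cases hyS : y ∈ S x
              · simpa [hyS] using hc x y
              · simp [hyS, hy hyS]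
          _ = μ.real (S x) * V := by rw [integral_indicator_const _ (hS x), smul_eq_mul]
          _ ≤ δ * V := mul_le_mul_of_nonneg_right (hSδ x) hV0
    _ = δ * V := by simp

theorem min_sq_le_rpow_mul_rpow {g M p : ℝ} (hg : 0 ≤ g) (hM : 0 < M) (hp1 : 1 ≤ p) (hp2 : p ≤ 2) :
    min g M ^ 2 ≤ M ^ (2 - p) * g ^ p := by
  have hT0 : 0 ≤ min g M := le_min hg hM.le
  calc min g M ^ 2 = min g M ^ (2 - p) * min g M ^ p := by
        rw [← Real.rpow_add_of_nonneg hT0 (by linarith) (by linarith), sub_add_cancel]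
        exact (Real.rpow_two _).symm
    _ ≤ M ^ (2 - p) * g ^ p := mul_le_mul
        (Real.rpow_le_rpow hT0 (min_le_right _ _) (by linarith))
        (Real.rpow_le_rpow hT0 (min_le_left _ _) (by linarith))
        (Real.rpow_nonneg hT0 _) (Real.rpow_nonneg hM.le _)

theorem sub_le_rpow_mul_rpow {g M p : ℝ} (hg : 0 ≤ g) (hM : 0 < M) (hp1 : 1 ≤ p) :
    g - M ≤ M ^ (1 - p) * g ^ p := by
  rcases le_or_gt g M with h | h
  · exact (sub_nonpos.2 h).trans (by positivity)
  · have hg' : 0 < g := hM.trans h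
    calc g - M ≤ g := by linarith
      _ = g ^ (1 - p) * g ^ p := by rw [← Real.rpow_add hg', sub_add_cancel, Real.rpow_one]
      _ ≤ M ^ (1 - p) * g ^ p := mul_le_mul_of_nonneg_right
          (Real.rpow_le_rpow_of_nonpos hM h.le (by linarith)) (by positivity)

/-- Upward deviations of the average of a nonnegative random field with bounded `p`-th moments,
`1 ≤ p ≤ 2`, whose values at `x` and `y` are independent unless `y ∈ S x`. The field is truncated at
an arbitrary level `M`: the first term is Markov's inequality for the excess over `M`, the second
one is Chebyshev's inequality for the centred truncation. -/
theorem measure_lintegral_gt_le {X Ω : Type*} [MeasurableSpace X] [MeasurableSpace Ω]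
    {μ : Measure X} [IsProbabilityMeasure μ] {P : Measure Ω} [IsProbabilityMeasure P]
    {G : X → Ω → ℝ} (hG : Measurable (Function.uncurry G)) (hG0 : ∀ x ω, 0 ≤ G x ω)
    {p m A δ M η : ℝ} (hp1 : 1 ≤ p) (hp2 : p ≤ 2) (hM : 0 < M) (hη : 0 < η) (hm0 : 0 ≤ m)
    (hA0 : 0 ≤ A) (hm : ∀ x, ∫⁻ ω, ENNReal.ofReal (G x ω) ∂P ≤ ENNReal.ofReal m)
    (hA : ∀ x, ∫⁻ ω, ENNReal.ofReal (G x ω ^ p) ∂P ≤ ENNReal.ofReal A)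
    {S : X → Set X} (hS : ∀ x, MeasurableSet (S x)) (hSδ : ∀ x, μ.real (S x) ≤ δ)
    (h0 : ∀ᵐ x ∂μ, ∀ᵐ y ∂μ, y ∉ S x → IndepFun (G x) (G y) P) :
    P {ω | ENNReal.ofReal (m + 2 * η) < ∫⁻ x, ENNReal.ofReal (G x ω) ∂μ} ≤
      ENNReal.ofReal (A * M ^ (1 - p) / η + δ * (A * M ^ (2 - p)) / η ^ 2) := by
  have hGx : ∀ x, Measurable (G x) := fun x => hG.comp measurable_prodMk_left
  have hδ0 : 0 ≤ δ := by
    obtain ⟨x⟩ : Nonempty X := μ.nonempty_of_neZero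
    exact measureReal_nonneg.trans (hSδ x)
  set T : X → Ω → ℝ := fun x ω => min (G x ω) M with hT
  have hTm : Measurable (Function.uncurry T) := hG.min measurable_const
  have hTx : ∀ x, Measurable (T x) := fun x => hTm.comp measurable_prodMk_left
  have hTω : ∀ ω, Measurable (fun x => T x ω) := fun ω => hTm.comp measurable_prodMk_right
  have hT0 : ∀ x ω, 0 ≤ T x ω := fun x ω => le_min (hG0 x ω) hM.le
  have hTM : ∀ x ω, T x ω ≤ M := fun x ω => min_le_right _ _
  have hTint : ∀ x, Integrable (T x) P := fun x =>
    Integrable.of_bound (hTx x).aestronglyMeasurable M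
      (Eventually.of_forall fun ω => by rw [Real.norm_of_nonneg (hT0 x ω)]; exact hTM x ω)
  have hTintω : ∀ ω, Integrable (fun x => T x ω) μ := fun ω =>
    Integrable.of_bound (hTω ω).aestronglyMeasurable M
      (Eventually.of_forall fun x => by rw [Real.norm_of_nonneg (hT0 x ω)]; exact hTM x ω)
  set e : X → ℝ := fun x => ∫ ω, T x ω ∂P with he
  have hem : Measurable e := (hTm.stronglyMeasurable.integral_prod_right (ν := P)).measurable
  have he0 : ∀ x, 0 ≤ e x := fun x => integral_nonneg (hT0 x)
  have heM : ∀ x, e x ≤ M := fun x => by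
    simpa using integral_mono (hTint x) (integrable_const M) (hTM x)
  have hem_le : ∀ x, e x ≤ m := fun x => by
    have h1 : ENNReal.ofReal (e x) ≤ ENNReal.ofReal m := by
      rw [he, ofReal_integral_eq_lintegral_ofReal (hTint x) (Eventually.of_forall (hT0 x))]
      exact (lintegral_mono fun ω => ENNReal.ofReal_le_ofReal (min_le_left _ _)).trans (hm x)
    exact (ENNReal.ofReal_le_ofReal_iff hm0).1 h1
  have heint : Integrable e μ := Integrable.of_bound hem.aestronglyMeasurable M
      (Eventually.of_forall fun x => by rw [Real.norm_of_nonneg (he0 x)]; exact heM x)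
  set Z : X → Ω → ℝ := fun x ω => T x ω - e x with hZdef
  have hZ : Measurable (Function.uncurry Z) := hTm.sub (hem.comp measurable_fst)
  have hZB : ∀ x ω, |Z x ω| ≤ M := fun x ω =>
    abs_le.2 ⟨by simp only [hZdef]; linarith [hT0 x ω, heM x],
      by simp only [hZdef]; linarith [hTM x ω, he0 x]⟩
  have hTsq : ∀ x, Integrable (fun ω => T x ω ^ 2) P := fun x =>
    Integrable.of_bound ((hTx x).pow_const 2).aestronglyMeasurable (M ^ 2)
      (Eventually.of_forall fun ω => by
        rw [Real.norm_of_nonneg (sq_nonneg _)]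
        exact pow_le_pow_left₀ (hT0 x ω) (hTM x ω) 2)
  have hZV : ∀ x, ∫ ω, Z x ω ^ 2 ∂P ≤ A * M ^ (2 - p) := fun x => by
    have h1 : ∫ ω, Z x ω ^ 2 ∂P ≤ ∫ ω, T x ω ^ 2 ∂P := by
      have h2 := variance_le_expectation_sq (μ := P) (X := T x) (hTx x).aestronglyMeasurable
      rw [variance_eq_integral (hTx x).aemeasurable] at h2
      exact h2
    refine h1.trans ?_
    rw [← ENNReal.ofReal_le_ofReal_iff (by positivity),
      ofReal_integral_eq_lintegral_ofReal (hTsq x) (Eventually.of_forall fun ω => sq_nonneg _)]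
    calc ∫⁻ ω, ENNReal.ofReal (T x ω ^ 2) ∂P
        ≤ ∫⁻ ω, ENNReal.ofReal (M ^ (2 - p)) * ENNReal.ofReal (G x ω ^ p) ∂P := by
          refine lintegral_mono fun ω => ?_
          rw [← ENNReal.ofReal_mul (by positivity)]
          exact ENNReal.ofReal_le_ofReal (min_sq_le_rpow_mul_rpow (hG0 x ω) hM hp1 hp2)
      _ ≤ ENNReal.ofReal (M ^ (2 - p)) * ENNReal.ofReal A := by
          rw [lintegral_const_mul _ ((hGx x).pow_const p).ennreal_ofReal]
          gcongr
          exact hA x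
      _ = ENNReal.ofReal (A * M ^ (2 - p)) := by
          rw [← ENNReal.ofReal_mul (by positivity), mul_comm]
  have hZ0 : ∀ x, ∫ ω, Z x ω ∂P = 0 := fun x => by
    simp only [hZdef]
    rw [integral_sub (hTint x) (integrable_const _)]
    simp [he]
  have hZorth : ∀ᵐ x ∂μ, ∀ᵐ y ∂μ, y ∉ S x → ∫ ω, Z x ω * Z y ω ∂P = 0 := by
    filter_upwards [h0] with x hx
    filter_upwards [hx] with y hy hyS
    have hind : IndepFun (Z x) (Z y) P := (hy hyS).comp
      (φ := fun g => min g M - e x) (ψ := fun g => min g M - e y) (by fun_prop) (by fun_prop)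
    have := hind.integral_fun_mul_eq_mul_integral
      (hZ.comp measurable_prodMk_left).aestronglyMeasurable
      (hZ.comp measurable_prodMk_left).aestronglyMeasurable
    rw [this, hZ0, zero_mul]
  have hsecond := integral_sq_integral_le hZ hZB (by positivity) hZV hS hSδ hZorth
  have hFm : Measurable fun ω => ∫ x, Z x ω ∂μ :=
    (hZ.stronglyMeasurable.integral_prod_left (μ := μ)).measurable
  have hFB : ∀ ω, |∫ x, Z x ω ∂μ| ≤ M := fun ω => by
    simpa using norm_integral_le_of_norm_le_const (μ := μ) (f := fun x => Z x ω)
      (Eventually.of_forall fun x => hZB x ω)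
  have hFsq : Integrable (fun ω => (∫ x, Z x ω ∂μ) ^ 2) P :=
    Integrable.of_bound (hFm.pow_const 2).aestronglyMeasurable (M ^ 2)
      (Eventually.of_forall fun ω => by
        rw [Real.norm_of_nonneg (sq_nonneg _), ← sq_abs]
        exact pow_le_pow_left₀ (abs_nonneg _) (hFB ω) 2)
  -- the mean of the excess over `M` is at most `A * M ^ (1 - p)`
  have hE1 : P {ω | ENNReal.ofReal η ≤ ∫⁻ x, ENNReal.ofReal (G x ω - M) ∂μ} ≤
      ENNReal.ofReal (A * M ^ (1 - p) / η) := by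
    have hRm : Measurable (Function.uncurry fun x ω => ENNReal.ofReal (G x ω - M)) :=
      (hG.sub measurable_const).ennreal_ofReal
    have hmark := meas_ge_le_lintegral_div (μ := P)
      (f := fun ω => ∫⁻ x, ENNReal.ofReal (G x ω - M) ∂μ)
      (hRm.lintegral_prod_left' (μ := μ)).aemeasurable
      (ε := ENNReal.ofReal η) (by simpa using hη) ENNReal.ofReal_ne_top
    refine hmark.trans ?_
    rw [ENNReal.ofReal_div_of_pos hη]
    gcongr
    rw [lintegral_lintegral_swap (f := fun ω x => ENNReal.ofReal (G x ω - M))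
      (hRm.comp measurable_swap).aemeasurable]
    calc ∫⁻ x, ∫⁻ ω, ENNReal.ofReal (G x ω - M) ∂P ∂μ
        ≤ ∫⁻ _, ENNReal.ofReal (A * M ^ (1 - p)) ∂μ := by
          refine lintegral_mono fun x => ?_
          calc ∫⁻ ω, ENNReal.ofReal (G x ω - M) ∂P
              ≤ ∫⁻ ω, ENNReal.ofReal (M ^ (1 - p)) * ENNReal.ofReal (G x ω ^ p) ∂P := by
                refine lintegral_mono fun ω => ?_
                rw [← ENNReal.ofReal_mul (by positivity)]
                exact ENNReal.ofReal_le_ofReal (sub_le_rpow_mul_rpow (hG0 x ω) hM hp1)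
            _ ≤ ENNReal.ofReal (M ^ (1 - p)) * ENNReal.ofReal A := by
                rw [lintegral_const_mul _ ((hGx x).pow_const p).ennreal_ofReal]
                gcongr
                exact hA x
            _ = ENNReal.ofReal (A * M ^ (1 - p)) := by
                rw [← ENNReal.ofReal_mul (by positivity), mul_comm]
      _ = ENNReal.ofReal (A * M ^ (1 - p)) := by simp
  -- the centred truncated average has variance at most `δ * (A * M ^ (2 - p))`
  have hE2 : P {ω | ENNReal.ofReal (η ^ 2) ≤ ENNReal.ofReal ((∫ x, Z x ω ∂μ) ^ 2)} ≤
      ENNReal.ofReal (δ * (A * M ^ (2 - p)) / η ^ 2) := by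
    have hmark := meas_ge_le_lintegral_div (μ := P)
      (f := fun ω => ENNReal.ofReal ((∫ x, Z x ω ∂μ) ^ 2))
      (hFm.pow_const 2).ennreal_ofReal.aemeasurable
      (ε := ENNReal.ofReal (η ^ 2)) (by simpa using hη.ne') ENNReal.ofReal_ne_top
    refine hmark.trans ?_
    rw [ENNReal.ofReal_div_of_pos (by positivity)]
    gcongr
    rw [← ofReal_integral_eq_lintegral_ofReal hFsq (Eventually.of_forall fun ω => sq_nonneg _)]
    exact ENNReal.ofReal_le_ofReal hsecond
  have hsub : {ω | ENNReal.ofReal (m + 2 * η) < ∫⁻ x, ENNReal.ofReal (G x ω) ∂μ} ⊆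
      {ω | ENNReal.ofReal η ≤ ∫⁻ x, ENNReal.ofReal (G x ω - M) ∂μ} ∪
      {ω | ENNReal.ofReal (η ^ 2) ≤ ENNReal.ofReal ((∫ x, Z x ω ∂μ) ^ 2)} := by
    intro ω hω
    by_contra hcon
    simp only [Set.mem_union, Set.mem_ofPred_eq, not_or, not_le] at hcon hω
    obtain ⟨hc1, hc2⟩ := hcon
    have hZlt : ∫ x, Z x ω ∂μ ≤ η := by
      rw [ENNReal.ofReal_lt_ofReal_iff (by positivity)] at hc2
      exact (le_abs_self _).trans (abs_lt_of_sq_lt_sq hc2 hη.le).le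
    have hTle : ∫ x, T x ω ∂μ ≤ m + η := by
      have h1 : ∫ x, Z x ω ∂μ = ∫ x, T x ω ∂μ - ∫ x, e x ∂μ :=
        integral_sub (hTintω ω) heint
      have h2 : ∫ x, e x ∂μ ≤ m := by
        simpa using integral_mono heint (integrable_const m) hem_le
      linarith
    refine absurd hω (not_lt.2 ?_)
    calc ∫⁻ x, ENNReal.ofReal (G x ω) ∂μ
        ≤ ∫⁻ x, (ENNReal.ofReal (T x ω) + ENNReal.ofReal (G x ω - M)) ∂μ := by
          refine lintegral_mono fun x => ?_
          rcases le_total (G x ω) M with h | h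
          · simp [hT, h]
          · simp only [hT, min_eq_right h]
            rw [← ENNReal.ofReal_add hM.le (sub_nonneg.2 h)]
            simp
      _ = ENNReal.ofReal (∫ x, T x ω ∂μ) + ∫⁻ x, ENNReal.ofReal (G x ω - M) ∂μ := by
          rw [lintegral_add_left (hTω ω).ennreal_ofReal,
            ofReal_integral_eq_lintegral_ofReal (hTintω ω)
              (Eventually.of_forall fun x => hT0 x ω)]
      _ ≤ ENNReal.ofReal (m + η) + ENNReal.ofReal η := by gcongr
      _ = ENNReal.ofReal (m + 2 * η) := by
          rw [← ENNReal.ofReal_add (by positivity) hη.le]; congr 1; ring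
  calc _ ≤ _ := measure_mono hsub
    _ ≤ _ := measure_union_le _ _
    _ ≤ _ := add_le_add hE1 hE2
    _ = _ := (ENNReal.ofReal_add (by positivity) (by positivity)).symm

/-! ### Gaussian integrals and Brownian increments -/

theorem lintegral_exp_mul_sq_gaussianReal {a : ℝ} (ha : a < 1 / 2) :
    ∫⁻ y, ENNReal.ofReal (Real.exp (a * y ^ 2)) ∂(gaussianReal 0 1) =
      ENNReal.ofReal (√(1 - 2 * a))⁻¹ := by
  have hb : 0 < 1 / 2 - a := by linarith
  have hpdf : ∀ y : ℝ, gaussianPDF 0 1 y * ENNReal.ofReal (Real.exp (a * y ^ 2)) =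
      ENNReal.ofReal ((√(2 * Real.pi))⁻¹ * Real.exp (-(1 / 2 - a) * y ^ 2)) := fun y => by
    rw [gaussianPDF, ← ENNReal.ofReal_mul (gaussianPDFReal_nonneg _ _ _), gaussianPDFReal,
      mul_assoc, ← Real.exp_add]
    congr 3
    · simp
    · simp; ring
  rw [gaussianReal_of_var_ne_zero _ one_ne_zero,
    lintegral_withDensity_eq_lintegral_mul _ (measurable_gaussianPDF 0 1) (by fun_prop)]
  simp only [Pi.mul_apply, hpdf]
  rw [← ofReal_integral_eq_lintegral_ofReal ((integrable_exp_neg_mul_sq hb).const_mul _)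
    (Eventually.of_forall fun y => by positivity), integral_const_mul, integral_gaussian]
  congr 1
  rw [← Real.sqrt_inv, ← Real.sqrt_inv, ← Real.sqrt_mul (by positivity)]
  congr 1
  have := Real.pi_ne_zero
  have h3 : 1 - 2 * a ≠ 0 := by linarith
  field_simp

variable {Ω : Type*} [MeasurableSpace Ω] {P : Measure Ω} {B : ℝ≥0 → Ω → ℝ}

/-- A Brownian motion agrees almost surely, at all times at once, with a process that is measurable
at each time and has only continuous paths. It is obtained by setting the path to zero off a
measurable set of full measure on which the path is continuous and agrees with measurable
modifications at a countable dense set of times. -/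
theorem exists_continuous_version {W : ℝ≥0 → Ω → ℝ} (hW : IsBrownianReal W P) :
    ∃ B : ℝ≥0 → Ω → ℝ, (∀ t, Measurable (B t)) ∧ (∀ ω, Continuous fun t => B t ω) ∧
      ∀ᵐ ω ∂P, ∀ t, W t ω = B t ω := by
  classical
  obtain ⟨D, hDc, hD⟩ := TopologicalSpace.exists_countable_dense ℝ≥0
  have hN : ∀ᵐ ω ∂P, (Continuous fun t => W t ω) ∧
      ∀ t ∈ D, W t ω = (hW.aemeasurable t).mk (W t) ω :=
    hW.cont.and ((ae_ball_iff hDc).2 fun t _ => (hW.aemeasurable t).ae_eq_mk)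
  obtain ⟨S, hSae, hSm, hS⟩ := hN.exists_measurable_mem
  refine ⟨fun t => S.indicator (W t), fun t => ?_, fun ω => ?_, ?_⟩
  · obtain ⟨u, huD, hut⟩ := mem_closure_iff_seq_limit.1 (hD t)
    refine measurable_of_tendsto_metrizable (f := fun n => S.indicator (W (u n))) (fun n => ?_) ?_
    · have : S.indicator (W (u n)) = S.indicator ((hW.aemeasurable (u n)).mk (W (u n))) := by
        refine Set.indicator_congr fun ω hω => (hS ω hω).2 _ (huD n)
      rw [this]
      exact (hW.aemeasurable (u n)).measurable_mk.indicator hSm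
    · rw [tendsto_pi_nhds]
      intro ω
      by_cases hω : ω ∈ S
      · simpa [hω, Function.comp_def] using ((hS ω hω).1.tendsto t).comp hut
      · simp [hω]
  · by_cases hω : ω ∈ S
    · simpa [hω] using (hS ω hω).1
    · simpa [hω] using continuous_const
  · filter_upwards [hSae] with ω hω t
    simp [hω]

theorem hasLaw_increment_div_sqrt (hB : IsPreBrownianReal B P) {s t : ℝ≥0} (hst : s < t) :
    HasLaw (fun ω => (B t ω - B s ω) / √((t : ℝ) - s)) (gaussianReal 0 1) P := by
  have h := gaussianReal_div_const (hB.hasLaw_sub t s) (√((t : ℝ) - s))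
  have hpos : (0 : ℝ) < t - s := sub_pos.2 (by exact_mod_cast hst)
  convert h using 2
  · simp
  · simp
  · apply NNReal.eq
    simp only [NNReal.coe_one, NNReal.coe_div, coe_nndist, NNReal.coe_mk]
    change 1 = dist (t : ℝ) s / _
    rw [Real.sq_sqrt hpos.le, Real.dist_eq, abs_of_pos hpos, div_self hpos.ne']

theorem lintegral_exp_sq_increment (hB : IsPreBrownianReal B P) {s t : ℝ≥0} (hst : s < t) {a : ℝ}
    (ha : a < 1 / 2) :
    ∫⁻ ω, ENNReal.ofReal (Real.exp (a * ((B t ω - B s ω) / √((t : ℝ) - s)) ^ 2)) ∂P =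
      ENNReal.ofReal (√(1 - 2 * a))⁻¹ := by
  rw [← lintegral_exp_mul_sq_gaussianReal ha]
  exact (hasLaw_increment_div_sqrt hB hst).lintegral_comp
    (f := fun y => ENNReal.ofReal (Real.exp (a * y ^ 2))) (by fun_prop)

theorem indepFun_increments (hB : IsPreBrownianReal B P) {h x y : ℝ≥0} (hxy : x + h ≤ y) :
    IndepFun (fun ω => B (x + h) ω - B x ω) (fun ω => B (y + h) ω - B y ω) P := by
  have h1 := (hB.indepFun_shift y).symm
  have hx : x ≤ y := (le_add_of_nonneg_right (zero_le)).trans hxy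
  exact h1.comp (φ := fun f : Set.Iic y → ℝ => f ⟨x + h, hxy⟩ - f ⟨x, hx⟩)
    (ψ := fun f : ℝ≥0 → ℝ => f h) (by fun_prop) (by fun_prop)

/-- The mean of `exp(N² / (√(8/3) + δ)²)`, for `N` standard Gaussian, falls below `2` at least
linearly in `δ`. -/
theorem inv_sqrt_one_sub_le {δ : ℝ} (hδ0 : 0 ≤ δ) (hδ1 : δ ≤ 1) :
    (√(1 - 2 * (1 / (√(8 / 3) + δ) ^ 2)))⁻¹ ≤ 2 - δ / 4 := by
  have h83 : (1 : ℝ) / 2 ≤ √(8 / 3) := Real.le_sqrt_of_sq_le (by norm_num)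
  have hsq : √(8 / 3 : ℝ) ^ 2 = 8 / 3 := Real.sq_sqrt (by norm_num)
  have hK : 8 / 3 + δ ≤ (√(8 / 3) + δ) ^ 2 := by nlinarith
  have h1 : 1 / (√(8 / 3) + δ) ^ 2 ≤ 1 / (8 / 3 + δ) := one_div_le_one_div_of_le (by positivity) hK
  have h2 : (2 + 3 * δ) / (8 + 3 * δ) ≤ 1 - 2 * (1 / (√(8 / 3) + δ) ^ 2) := by
    have : (2 + 3 * δ) / (8 + 3 * δ) = 1 - 2 * (1 / (8 / 3 + δ)) := by field_simp; ring
    linarith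
  have h3 : 0 < 2 - δ / 4 := by linarith
  rw [inv_le_comm₀ (Real.sqrt_pos.2 (lt_of_lt_of_le (by positivity) h2)) h3]
  refine Real.le_sqrt_of_sq_le (le_trans ?_ h2)
  rw [inv_pow, inv_le_comm₀ (by positivity) (by positivity), inv_div,
    div_le_iff₀ (by positivity)]
  nlinarith [mul_nonneg hδ0 hδ0, mul_nonneg (mul_nonneg hδ0 hδ0) hδ0, mul_nonneg hδ0 (sub_nonneg.2 hδ1)]

/-! ### The integral of `Ψ₂` of the increments at a fixed lag -/

/-- The probability that `(√(8/3) + h^s) √h` is too small a constant for the modulus at `h`. The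
integral runs over `[0, 1]` rather than `[0, 1 - h]`, which costs nothing because `W` lives on the
whole half-line, and makes the domain independent of `h`. -/
theorem exists_measure_one_lt_lintegral_Psi2_le (hB : IsPreBrownianReal B P)
    (hBm : ∀ t, Measurable (B t)) (hBc : ∀ ω, Continuous fun t => B t ω)
    {s p : ℝ} (hs : 0 < s) (hp1 : 1 ≤ p) (hp : p < 4 / 3) :
    ∃ A : ℝ, ∀ h : ℝ, 0 < h → h ≤ 1 →
      P {ω | 1 < ∫⁻ x in Set.Icc (0 : ℝ) 1, ENNReal.ofReal
        (Psi2 (|B (x + h).toNNReal ω - B x.toNNReal ω| / ((√(8 / 3) + h ^ s) * √h)))} ≤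
      ENNReal.ofReal (A * h ^ (p - 1 - s * p)) := by
  set A : ℝ := (√(1 - 2 * (p * (3 / 8))))⁻¹ with hA
  have hA0 : 0 ≤ A := by positivity
  refine ⟨A * 8 + 2 * A * 64, fun h hh hh1 => ?_⟩
  have : IsProbabilityMeasure P := hB.isGaussianProcess.isProbabilityMeasure
  have hμ : IsProbabilityMeasure (volume.restrict (Set.Icc (0 : ℝ) 1)) := ⟨by simp⟩
  set K := √(8 / 3) + h ^ s with hK
  have hδ0 : 0 < h ^ s := Real.rpow_pos_of_pos hh s
  have hδ1 : h ^ s ≤ 1 := Real.rpow_le_one hh.le hh1 hs.le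
  have hK0 : 0 < K := by positivity
  have hKsq : 1 / K ^ 2 ≤ 3 / 8 := by
    rw [div_le_iff₀ (by positivity)]
    have : √(8 / 3 : ℝ) ^ 2 = 8 / 3 := Real.sq_sqrt (by norm_num)
    nlinarith [Real.sqrt_nonneg (8 / 3 : ℝ)]
  have hunc : Measurable (Function.uncurry B) :=
    measurable_uncurry_of_continuous_of_measurable hBc hBm
  set N : ℝ → Ω → ℝ := fun x ω => B (x.toNNReal + h.toNNReal) ω - B x.toNNReal ω with hN
  have hNm : Measurable (Function.uncurry N) :=
    (hunc.comp (f := fun q : ℝ × Ω => (q.1.toNNReal + h.toNNReal, q.2)) (by fun_prop)).sub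
      (hunc.comp (f := fun q : ℝ × Ω => (q.1.toNNReal, q.2)) (by fun_prop))
  -- the integrand of `Ψ₂` plus one, so that the event is a deviation of `∫ G` above `2`
  set G : ℝ → Ω → ℝ := fun x ω => Real.exp (1 / K ^ 2 * (N x ω / √h) ^ 2) with hG
  have hGm : Measurable (Function.uncurry G) :=
    Real.measurable_exp.comp (((hNm.div_const _).pow_const 2).const_mul _)
  have hexp : ∀ (x : ℝ) {a : ℝ}, a < 1 / 2 →
      ∫⁻ ω, ENNReal.ofReal (Real.exp (a * (N x ω / √h) ^ 2)) ∂P =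
        ENNReal.ofReal (√(1 - 2 * a))⁻¹ := fun x a ha => by
    have h1 := lintegral_exp_sq_increment hB (s := x.toNNReal) (t := x.toNNReal + h.toNNReal)
      (lt_add_of_pos_right _ (by simpa using hh)) ha
    rw [NNReal.coe_add, add_sub_cancel_left, Real.coe_toNNReal h hh.le] at h1
    exact h1
  -- `M = h ^ (s - 1)` balances the two terms of the truncation bound
  have hmain := measure_lintegral_gt_le (μ := volume.restrict (Set.Icc (0 : ℝ) 1)) (P := P)
    (G := G) hGm (fun x ω => (Real.exp_pos _).le) (p := p) (m := 2 - h ^ s / 4) (A := A)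
    (δ := 2 * h) (M := h ^ (s - 1)) (η := h ^ s / 8) hp1 (by linarith) (by positivity)
    (by positivity) (by linarith) hA0
    (fun x => by
      rw [hexp x (by linarith)]
      exact ENNReal.ofReal_le_ofReal (inv_sqrt_one_sub_le hδ0.le hδ1))
    (fun x => by
      calc ∫⁻ ω, ENNReal.ofReal (G x ω ^ p) ∂P
          ≤ ∫⁻ ω, ENNReal.ofReal (Real.exp (p * (3 / 8) * (N x ω / √h) ^ 2)) ∂P := by
            refine lintegral_mono fun ω => ENNReal.ofReal_le_ofReal ?_
            simp only [hG]
            rw [← Real.exp_mul, Real.exp_le_exp]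
            have := mul_le_mul_of_nonneg_right hKsq
              (mul_nonneg (by linarith : (0 : ℝ) ≤ p) (sq_nonneg (N x ω / √h)))
            linarith
        _ = ENNReal.ofReal A := hexp x (by linarith))
    (S := fun x => Set.Ioo (x - h) (x + h)) (fun x => measurableSet_Ioo)
    (fun x => by
      refine (ENNReal.toReal_mono (by simp) (Measure.restrict_apply_le _ _)).trans ?_
      change volume.real _ ≤ _
      rw [Real.volume_real_Ioo_of_le (by linarith)]
      linarith)
    (by
      filter_upwards [ae_restrict_mem measurableSet_Icc] with x hx
      filter_upwards [ae_restrict_mem measurableSet_Icc] with y hy hxy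
      have key : ∀ u v : ℝ, 0 ≤ u → u + h ≤ v → IndepFun (G u) (G v) P := fun u v hu huv => by
        have h1 := indepFun_increments hB (h := h.toNNReal) (x := u.toNNReal) (y := v.toNNReal)
          (by rw [← Real.toNNReal_add hu hh.le]; exact Real.toNNReal_le_toNNReal huv)
        exact h1.comp (φ := fun z => Real.exp (1 / K ^ 2 * (z / √h) ^ 2))
          (ψ := fun z => Real.exp (1 / K ^ 2 * (z / √h) ^ 2)) (by fun_prop) (by fun_prop)
      rw [Set.mem_Ioo, not_and_or, not_lt, not_lt] at hxy
      rcases hxy with hxy | hxy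
      · exact (key y x hy.1 (by linarith)).symm
      · exact key x y hx.1 hxy)
  refine (measure_mono ?_).trans (hmain.trans_eq ?_)
  · intro ω hω
    simp only [Set.mem_ofPred_eq] at hω ⊢
    have h2 : 2 - h ^ s / 4 + 2 * (h ^ s / 8) = 1 + 1 := by ring
    rw [h2, ENNReal.ofReal_add zero_le_one zero_le_one, ENNReal.ofReal_one]
    have hGω : ∀ x ∈ Set.Icc (0 : ℝ) 1, ENNReal.ofReal (G x ω) =
        ENNReal.ofReal (Psi2 (|B (x + h).toNNReal ω - B x.toNNReal ω| / (K * √h))) + 1 :=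
      fun x hx => by
        rw [← ENNReal.ofReal_one, ← ENNReal.ofReal_add _ zero_le_one]
        · congr 1
          simp only [hG, hN, Psi2, sub_add_cancel, Real.toNNReal_add hx.1 hh.le]
          rw [div_pow, div_pow, sq_abs, mul_pow]
          congr 1
          field_simp
        · simp only [Psi2, sub_nonneg]
          exact Real.one_le_exp (sq_nonneg _)
    rw [setLIntegral_congr_fun measurableSet_Icc hGω, lintegral_add_right _ measurable_const]
    simp only [lintegral_const, measure_univ, mul_one]
    exact ENNReal.add_lt_add_right ENNReal.one_ne_top hω
  · congr 1
    have e1 : (h ^ (s - 1)) ^ (1 - p) / (h ^ s / 8) = 8 * h ^ (p - 1 - s * p) := by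
      rw [← Real.rpow_mul hh.le, div_div_eq_mul_div, mul_comm _ (8 : ℝ), mul_div_assoc,
        ← Real.rpow_sub hh]
      ring_nf
    have e2 : 2 * h * (A * (h ^ (s - 1)) ^ (2 - p)) / (h ^ s / 8) ^ 2 =
        2 * A * 64 * h ^ (p - 1 - s * p) := by
      have : h ^ (p - 1 - s * p) = h * (h ^ (s - 1)) ^ (2 - p) / (h ^ s) ^ 2 := by
        rw [← Real.rpow_natCast, ← Real.rpow_mul hh.le, ← Real.rpow_mul hh.le,
          ← Real.rpow_one_add' hh.le, ← Real.rpow_sub hh]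
        · push_cast; ring_nf
        · nlinarith
      rw [this]
      field_simp
      norm_num
    rw [e2, mul_div_assoc, e1]
    ring

/-! ### The bound in probability -/

theorem orliczModulus_le {Ψ : ℝ → ℝ} {h K : ℝ} {f : ℝ → ℝ} (hh : 0 ≤ h) (hK : 0 < K)
    (hle : ∫⁻ x in Set.Icc (0 : ℝ) 1, ENNReal.ofReal (Ψ (|f (x + h) - f x| / K)) ≤ 1) :
    orliczModulus Ψ h f ≤ ENNReal.ofReal K := by
  refine iInf_le_of_le K (iInf_le_of_le hK (iInf_le _ (le_trans ?_ hle)))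
  exact lintegral_mono_set (Set.Icc_subset_Icc_right (by linarith))

omit [MeasurableSpace Ω] in
theorem modulusExcess_le_of_lintegral_le {W : ℝ≥0 → Ω → ℝ} {h K d : ℝ} {ω : Ω} (hh : 0 < h)
    (hK : 0 < K) (hd : K / √h ≤ √(8 / 3) + d)
    (hle : ∫⁻ x in Set.Icc (0 : ℝ) 1, ENNReal.ofReal
        (Psi2 (|W (x + h).toNNReal ω - W x.toNNReal ω| / K)) ≤ 1) :
    modulusExcess W h ω ≤ ENNReal.ofReal d := by
  rw [modulusExcess, tsub_le_iff_right]
  calc _ ≤ ENNReal.ofReal K / ENNReal.ofReal (√h) :=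
        ENNReal.div_le_div_right (orliczModulus_le hh.le hK hle) _
    _ = ENNReal.ofReal (K / √h) := (ENNReal.ofReal_div_of_pos (Real.sqrt_pos.2 hh)).symm
    _ ≤ ENNReal.ofReal (d + √(8 / 3)) := ENNReal.ofReal_le_ofReal (by linarith)
    _ ≤ _ := ENNReal.ofReal_add_le

/-- With an exponent `r ∈ (s, 1/4)` in place of `s`, the probabilities of exceeding `h ^ r` tend to
zero, so the constant `1` works for every `ε`. -/
theorem isBigOInProbability_modulusExcess {W : ℝ≥0 → Ω → ℝ} (hW : IsBrownianReal W P)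
    {s : ℝ} (hs : s < 1 / 4) :
    IsBigOInProbability P (modulusExcess W) (fun h => h ^ s) := by
  obtain ⟨B, hBm, hBc, hWB⟩ := exists_continuous_version hW
  have hB : IsPreBrownianReal B P := hW.congr fun t => hWB.mono fun ω hω => hω t
  obtain ⟨r, hr0, hr1⟩ := exists_between (max_lt hs (by norm_num : (0 : ℝ) < 1 / 4))
  obtain ⟨hsr, hr0⟩ := max_lt_iff.1 hr0
  -- `1 / (1 - r) < p` makes the exponent `p - 1 - r * p` positive
  obtain ⟨p, hp1, hp⟩ : ∃ p, 1 / (1 - r) < p ∧ p < 4 / 3 := by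
    refine exists_between ?_
    rw [div_lt_div_iff₀ (by linarith) (by norm_num)]
    linarith
  have hexp : 0 < p - 1 - r * p := by
    rw [div_lt_iff₀ (by linarith)] at hp1
    linarith
  have hp1' : 1 ≤ p := by nlinarith
  obtain ⟨A, hA⟩ := exists_measure_one_lt_lintegral_Psi2_le hB hBm hBc hr0 hp1' hp
  intro ε hε
  refine ⟨1, ?_⟩
  have hlim : Tendsto (fun h : ℝ => A * h ^ (p - 1 - r * p)) (𝓝[>] 0) (𝓝 0) := by
    have h1 : ContinuousAt (fun h : ℝ => A * h ^ (p - 1 - r * p)) 0 :=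
      continuousAt_const.mul (Real.continuousAt_rpow_const _ _ (Or.inr hexp.le))
    have h2 := h1.tendsto.mono_left (nhdsWithin_le_nhds (s := Set.Ioi 0))
    simpa [Real.zero_rpow hexp.ne'] using h2
  filter_upwards [hlim.eventually (gt_mem_nhds hε), Ioo_mem_nhdsGT (zero_lt_one (α := ℝ))]
    with h hAh ⟨hh, hh1⟩
  refine le_trans ?_ ((hA h hh hh1.le).trans (ENNReal.ofReal_le_ofReal hAh.le))
  refine measure_mono_ae ?_
  filter_upwards [hWB] with ω hω hgt
  by_contra hcon
  have hle := not_lt.1 hcon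
  simp_rw [← hω] at hle
  refine absurd hgt (not_lt.2 ?_)
  rw [ENNReal.coe_one, one_mul]
  refine (modulusExcess_le_of_lintegral_le hh (by positivity) (d := h ^ r) ?_ hle).trans
    (ENNReal.ofReal_le_ofReal (Real.rpow_le_rpow_of_exponent_ge hh hh1.le hsr.le))
  rw [mul_div_cancel_right₀ _ (Real.sqrt_pos.2 hh).ne']

/-! ### Hölder continuity of Brownian paths -/

theorem tendsto_floor_two_pow_div (t : ℝ≥0) :
    Tendsto (fun n : ℕ => (⌊(2 : ℝ≥0) ^ n * t⌋₊ : ℝ≥0) / 2 ^ n) atTop (𝓝 t) := by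
  rw [← NNReal.tendsto_coe]
  have h := (tendsto_nat_floor_mul_div_atTop (R := ℝ) t.coe_nonneg).comp
    (tendsto_pow_atTop_atTop_of_one_lt (one_lt_two (α := ℝ)))
  refine h.congr fun n => ?_
  simp only [Function.comp_apply, NNReal.coe_div, NNReal.coe_natCast, NNReal.coe_pow,
    NNReal.coe_ofNat]
  have hfl : ⌊(2 : ℝ≥0) ^ n * t⌋₊ = ⌊(((2 : ℝ≥0) ^ n * t : ℝ≥0) : ℝ)⌋₊ :=
    (Nonneg.nat_floor_coe _).symm
  rw [hfl, mul_comm (t : ℝ)]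
  push_cast
  rfl

/-- Dyadic chaining: a continuous function whose increments over dyadic intervals of length
`2⁻ⁿ` in `[0, 2]` are at most `rⁿ` for `n ≥ N` moves by at most a multiple of `rⁿ` over any interval
of length at most `2⁻ⁿ`. -/
theorem abs_sub_le_of_dyadic {f : ℝ≥0 → ℝ} (hf : Continuous f) {r : ℝ} (hr0 : 0 < r) (hr1 : r < 1)
    {N : ℕ} (hN : ∀ n, N ≤ n → ∀ j : ℕ, j < 2 * 2 ^ n →
      |f ((j + 1 : ℕ) / 2 ^ n) - f (j / 2 ^ n)| ≤ r ^ n)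
    {n : ℕ} (hn : N ≤ n) {s t : ℝ≥0} (hst : s ≤ t) (ht : t < 2) (hts : t ≤ s + 1 / 2 ^ n) :
    |f t - f s| ≤ 3 / (1 - r) * r ^ n := by
  have h1r : 0 < 1 - r := sub_pos.2 hr1
  have hfl : ∀ {u : ℝ≥0}, u < 2 → ∀ m : ℕ, ⌊(2 : ℝ≥0) ^ m * u⌋₊ < 2 * 2 ^ m := fun hu m => by
    rw [Nat.floor_lt (by positivity)]
    push_cast
    rw [mul_comm]
    gcongr
  -- telescoping along the dyadic approximations of `u` from below
  have happ : ∀ u : ℝ≥0, u < 2 →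
      |f (⌊(2 : ℝ≥0) ^ n * u⌋₊ / 2 ^ n) - f u| ≤ r ^ n / (1 - r) := fun u hu => by
    have hlim := ((hf.tendsto u).comp (tendsto_floor_two_pow_div u)).comp (tendsto_add_atTop_nat n)
    have hstep : ∀ m : ℕ, dist (f (⌊(2 : ℝ≥0) ^ (m + n) * u⌋₊ / 2 ^ (m + n)))
        (f (⌊(2 : ℝ≥0) ^ (m + 1 + n) * u⌋₊ / 2 ^ (m + 1 + n))) ≤ r ^ n * r ^ m := fun m => by
      set k := ⌊(2 : ℝ≥0) ^ (m + n) * u⌋₊ with hk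
      have hk1 : 2 * k ≤ ⌊(2 : ℝ≥0) ^ (m + 1 + n) * u⌋₊ := by
        apply Nat.le_floor
        push_cast
        rw [show m + 1 + n = (m + n) + 1 by ring, pow_succ', mul_assoc]
        gcongr
        exact Nat.floor_le zero_le
      have hk2 : ⌊(2 : ℝ≥0) ^ (m + 1 + n) * u⌋₊ < 2 * k + 2 := by
        rw [Nat.floor_lt zero_le]
        push_cast
        rw [show m + 1 + n = (m + n) + 1 by ring, pow_succ', mul_assoc,
          show (2 * (k : ℝ≥0) + 2) = 2 * (k + 1) by ring]
        gcongr
        exact Nat.lt_floor_add_one _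
      have hkk : (k : ℝ≥0) / 2 ^ (m + n) = ((2 * k : ℕ) : ℝ≥0) / 2 ^ (m + 1 + n) := by
        push_cast
        rw [show m + 1 + n = (m + n) + 1 by ring, pow_succ']
        rw [mul_div_mul_left _ _ two_ne_zero]
      have hrle : r ^ (m + 1 + n) ≤ r ^ n * r ^ m := by
        rw [← pow_add]
        exact pow_le_pow_of_le_one hr0.le hr1.le (by omega)
      rw [hkk, dist_comm, Real.dist_eq]
      refine le_trans ?_ hrle
      obtain h | h : ⌊(2 : ℝ≥0) ^ (m + 1 + n) * u⌋₊ = 2 * k ∨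
        ⌊(2 : ℝ≥0) ^ (m + 1 + n) * u⌋₊ = 2 * k + 1 := by omega
      · rw [h, sub_self, abs_zero]
        positivity
      · rw [h]
        exact hN _ (by omega) _ (by have := hfl hu (m + 1 + n); omega)
    have := dist_le_of_le_geometric_of_tendsto₀ r (r ^ n) hr1 hstep hlim
    simpa [Real.dist_eq] using this
  have hs : s < 2 := hst.trans_lt ht
  have hmid : |f (⌊(2 : ℝ≥0) ^ n * t⌋₊ / 2 ^ n) - f (⌊(2 : ℝ≥0) ^ n * s⌋₊ / 2 ^ n)| ≤ r ^ n := by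
    have h1 : ⌊(2 : ℝ≥0) ^ n * s⌋₊ ≤ ⌊(2 : ℝ≥0) ^ n * t⌋₊ := Nat.floor_le_floor (by gcongr)
    have h2 : ⌊(2 : ℝ≥0) ^ n * t⌋₊ ≤ ⌊(2 : ℝ≥0) ^ n * s⌋₊ + 1 := by
      rw [← Nat.floor_add_one zero_le]
      apply Nat.floor_le_floor
      calc (2 : ℝ≥0) ^ n * t ≤ 2 ^ n * (s + 1 / 2 ^ n) := by gcongr
        _ = 2 ^ n * s + 1 := by field_simp
    obtain h | h : ⌊(2 : ℝ≥0) ^ n * t⌋₊ = ⌊(2 : ℝ≥0) ^ n * s⌋₊ ∨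
      ⌊(2 : ℝ≥0) ^ n * t⌋₊ = ⌊(2 : ℝ≥0) ^ n * s⌋₊ + 1 := by omega
    · rw [h, sub_self, abs_zero]
      positivity
    · rw [h]
      exact hN n hn _ (hfl hs n)
  have hrn : r ^ n ≤ r ^ n / (1 - r) := le_div_self (by positivity) h1r (by linarith)
  have e : 3 / (1 - r) * r ^ n = r ^ n / (1 - r) + r ^ n / (1 - r) + r ^ n / (1 - r) := by ring
  have h1 := happ s hs
  have h2 := happ t ht
  rw [e]
  rw [abs_le] at h1 h2 hmid ⊢
  constructor <;> linarith [h1.1, h1.2, h2.1, h2.2, hmid.1, hmid.2]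

/-- The Hölder form of dyadic chaining, for intervals of length at most `2⁻ᴺ`. -/
theorem exists_holder_bound_of_dyadic {f : ℝ≥0 → ℝ} (hf : Continuous f) {γ : ℝ} (hγ : 0 < γ)
    {N : ℕ} (hN : ∀ n, N ≤ n → ∀ j : ℕ, j < 2 * 2 ^ n →
      |f ((j + 1 : ℕ) / 2 ^ n) - f (j / 2 ^ n)| ≤ ((1 / 2 : ℝ) ^ γ) ^ n) :
    ∃ C : ℝ, 0 < C ∧ ∀ s t : ℝ≥0, s ≤ t → t < 2 → ∀ d : ℝ, 0 < d → d ≤ (1 / 2) ^ N →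
      (t : ℝ) - s ≤ d → |f t - f s| ≤ C * d ^ γ := by
  set r := (1 / 2 : ℝ) ^ γ with hr
  have hr0 : 0 < r := by positivity
  have hr1 : r < 1 := Real.rpow_lt_one (by norm_num) (by norm_num) hγ
  have h1r : 0 < 1 - r := sub_pos.2 hr1
  refine ⟨3 / (1 - r) * r⁻¹, by positivity, fun s t hst ht d hd hdN hds => ?_⟩
  obtain ⟨n, hn1, hn2⟩ := exists_nat_pow_near_of_lt_one hd
    (hdN.trans (pow_le_one₀ (by norm_num) (by norm_num))) (by norm_num : (0 : ℝ) < 1 / 2)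
    (by norm_num : (1 / 2 : ℝ) < 1)
  have hNn : N ≤ n := by
    by_contra hcon
    have : (1 / 2 : ℝ) ^ N ≤ (1 / 2) ^ (n + 1) :=
      pow_le_pow_of_le_one (by norm_num) (by norm_num) (by omega)
    linarith
  have h1 := abs_sub_le_of_dyadic hf hr0 hr1 hN hNn hst ht (by
    rw [← NNReal.coe_le_coe]
    push_cast
    have : (1 / 2 : ℝ) ^ n = 1 / 2 ^ n := by simp
    linarith)
  have h2 : r ^ (n + 1) ≤ d ^ γ := by
    rw [hr, ← Real.rpow_natCast, ← Real.rpow_mul (by norm_num), mul_comm γ,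
      Real.rpow_mul (by norm_num), Real.rpow_natCast]
    exact Real.rpow_le_rpow (by positivity) hn1.le hγ.le
  calc |f t - f s| ≤ 3 / (1 - r) * r ^ n := h1
    _ = 3 / (1 - r) * r⁻¹ * r ^ (n + 1) := by field_simp; ring
    _ ≤ 3 / (1 - r) * r⁻¹ * d ^ γ := by gcongr

/-- Chernoff bound for Brownian increments, from the exponential moment of `N² / 4`. -/
theorem measure_lt_abs_increment_le (hB : IsPreBrownianReal B P) {s t : ℝ≥0} (hst : s < t)
    {y : ℝ} (hy : 0 ≤ y) :
    P {ω | y * √((t : ℝ) - s) < |B t ω - B s ω|} ≤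
      ENNReal.ofReal ((√(1 - 2 * (1 / 4)))⁻¹ * Real.exp (-(y ^ 2 / 4))) := by
  have hpos : 0 < √((t : ℝ) - s) := Real.sqrt_pos.2 (sub_pos.2 (by exact_mod_cast hst))
  have hm : AEMeasurable (fun ω => ENNReal.ofReal
      (Real.exp (1 / 4 * ((B t ω - B s ω) / √((t : ℝ) - s)) ^ 2))) P := by
    have h1 := hB.aemeasurable t
    have h2 := hB.aemeasurable s
    fun_prop
  have h := meas_ge_le_lintegral_div hm (ε := ENNReal.ofReal (Real.exp (y ^ 2 / 4)))
    (by simpa using Real.exp_pos _) ENNReal.ofReal_ne_top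
  rw [lintegral_exp_sq_increment hB hst (by norm_num),
    ← ENNReal.ofReal_div_of_pos (Real.exp_pos _),
    div_eq_mul_inv _ (Real.exp _), ← Real.exp_neg] at h
  refine le_trans (measure_mono fun ω hω => ?_) h
  simp only [Set.mem_ofPred_eq] at hω ⊢
  refine ENNReal.ofReal_le_ofReal (Real.exp_le_exp.2 ?_)
  rw [← lt_div_iff₀ hpos] at hω
  have h3 : y ^ 2 ≤ ((B t ω - B s ω) / √((t : ℝ) - s)) ^ 2 := by
    rw [← sq_abs ((B t ω - B s ω) / _), abs_div, abs_of_pos hpos]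
    exact pow_le_pow_left₀ hy hω.le 2
  linarith

theorem summable_two_pow_mul_exp_neg {q : ℝ} (hq : 1 < q) :
    Summable fun n : ℕ => (2 : ℝ) ^ n * Real.exp (-(q ^ n / 4)) := by
  obtain ⟨m, hm⟩ := pow_unbounded_of_one_lt 2 hq
  have hq0 : 0 < q := by linarith
  have hgeo : Summable fun n : ℕ => (m.factorial * 4 ^ m : ℝ) * (2 / q ^ m) ^ n :=
    (summable_geometric_of_lt_one (by positivity)
      ((div_lt_one (by positivity)).2 hm)).mul_left _
  refine Summable.of_nonneg_of_le (fun n => by positivity) (fun n => ?_) hgeo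
  have h1 := Real.pow_div_factorial_le_exp (q ^ n / 4) (by positivity) m
  rw [Real.exp_neg]
  calc (2 : ℝ) ^ n * (Real.exp (q ^ n / 4))⁻¹
      ≤ 2 ^ n * ((q ^ n / 4) ^ m / m.factorial)⁻¹ := by gcongr
    _ = (m.factorial * 4 ^ m : ℝ) * (2 / q ^ m) ^ n := by
      rw [div_pow, div_pow, inv_div, ← pow_mul, ← pow_mul, mul_comm n m]
      field_simp

theorem ae_eventually_dyadic_increment_le (hB : IsPreBrownianReal B P) {r : ℝ} (hr0 : 0 < r)
    (hr : 1 < 2 * r ^ 2) :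
    ∀ᵐ ω ∂P, ∀ᶠ n : ℕ in atTop, ∀ j : ℕ, j < 2 * 2 ^ n →
      |B ((j + 1 : ℕ) / 2 ^ n) ω - B (j / 2 ^ n) ω| ≤ r ^ n := by
  set c : ℝ := (√(1 - 2 * (1 / 4)))⁻¹ with hc
  set E : ℕ → ℕ → Set Ω := fun n j =>
    {ω | r ^ n < |B ((j + 1 : ℕ) / 2 ^ n) ω - B (j / 2 ^ n) ω|} with hE
  have hEle : ∀ n j, P (E n j) ≤ ENNReal.ofReal (c * Real.exp (-((2 * r ^ 2) ^ n / 4))) :=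
      fun n j => by
    have hlt : (j : ℝ≥0) / 2 ^ n < (j + 1 : ℕ) / 2 ^ n := by
      push_cast
      gcongr
      simp
    have h := measure_lt_abs_increment_le hB hlt (y := r ^ n * √(2 ^ n)) (by positivity)
    have hd : (((j + 1 : ℕ) / 2 ^ n : ℝ≥0) : ℝ) - (j / 2 ^ n : ℝ≥0) = (2 ^ n)⁻¹ := by
      push_cast
      ring
    rw [hd, Real.sqrt_inv, mul_assoc, mul_inv_cancel₀ (by positivity), mul_one, mul_pow,
      Real.sq_sqrt (by positivity)] at h
    convert h using 5
    rw [mul_pow]; ring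
  have hsum : ∑' n, P (⋃ j ∈ Finset.range (2 * 2 ^ n), E n j) ≠ ∞ := by
    have hs := (summable_two_pow_mul_exp_neg hr).mul_left (2 * c)
    refine ne_top_of_le_ne_top hs.tsum_ofReal_ne_top (ENNReal.tsum_le_tsum fun n => ?_)
    refine (measure_biUnion_finset_le _ _).trans ((Finset.sum_le_sum fun j _ => hEle n j).trans ?_)
    rw [Finset.sum_const, Finset.card_range, nsmul_eq_mul, ← ENNReal.ofReal_natCast,
      ← ENNReal.ofReal_mul (by positivity)]
    refine ENNReal.ofReal_le_ofReal (le_of_eq ?_)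
    push_cast
    ring
  filter_upwards [ae_eventually_notMem hsum] with ω hω
  filter_upwards [hω] with n hn j hj
  by_contra hcon
  exact hn (Set.mem_biUnion (Finset.mem_coe.2 (Finset.mem_range.2 hj)) (not_le.1 hcon))

/-- Local Hölder continuity of Brownian paths on `[0, 2)` with any exponent `γ < 1/2`, at scales
below a random threshold `d₀`. -/
theorem ae_exists_holder_bound (hB : IsPreBrownianReal B P)
    (hBc : ∀ ω, Continuous fun t => B t ω) {γ : ℝ} (hγ0 : 0 < γ) (hγ : γ < 1 / 2) :
    ∀ᵐ ω ∂P, ∃ C : ℝ, ∃ d₀ : ℝ, 0 < C ∧ 0 < d₀ ∧ ∀ s t : ℝ≥0, s ≤ t → t < 2 → ∀ d : ℝ, 0 < d →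
      d ≤ d₀ → (t : ℝ) - s ≤ d → |B t ω - B s ω| ≤ C * d ^ γ := by
  have hr : 1 < 2 * ((1 / 2 : ℝ) ^ γ) ^ 2 := by
    have h1 : (1 / 2 : ℝ) < ((1 / 2 : ℝ) ^ γ) ^ 2 := by
      rw [← Real.rpow_natCast, ← Real.rpow_mul (by norm_num)]
      conv_lhs => rw [← Real.rpow_one (1 / 2 : ℝ)]
      exact Real.rpow_lt_rpow_of_exponent_gt (by norm_num) (by norm_num) (by push_cast; linarith)
    linarith
  filter_upwards [ae_eventually_dyadic_increment_le hB (by positivity) hr] with ω hω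
  obtain ⟨N, hN⟩ := eventually_atTop.1 hω
  obtain ⟨C, hC, h⟩ := exists_holder_bound_of_dyadic (hBc ω) hγ0 hN
  exact ⟨C, (1 / 2) ^ N, hC, by positivity, h⟩

/-! ### The almost sure bound -/

theorem Psi2_le_Psi2 {x y : ℝ} (hx : 0 ≤ x) (hxy : x ≤ y) : Psi2 x ≤ Psi2 y := by
  simp only [Psi2]
  gcongr

theorem convexOn_Psi2 : ConvexOn ℝ Set.univ Psi2 := by
  refine ⟨convex_univ, fun x _ y _ a b ha hb hab => ?_⟩
  have h1 := (even_two.convexOn_pow (𝕜 := ℝ)).2 (Set.mem_univ x) (Set.mem_univ y) ha hb hab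
  have h2 := convexOn_exp.2 (Set.mem_univ (x ^ 2)) (Set.mem_univ (y ^ 2)) ha hb hab
  have h3 := (Real.exp_le_exp.2 h1).trans h2
  simp only [Psi2, smul_eq_mul] at h3 ⊢
  linarith

/-- Enlarging an admissible constant `A` by `2β` makes up for a perturbation by at most `β`: the
larger constant weighs `|v| / A` against `1/2`, and `Ψ₂(1/2) ≤ 1`. -/
theorem lintegral_Psi2_le_one_of_abs_le {u v : ℝ → ℝ} {A β : ℝ} (hA : 0 < A) (hβ : 0 < β)
    (hv : ∫⁻ x in Set.Icc (0 : ℝ) 1, ENNReal.ofReal (Psi2 (|v x| / A)) ≤ 1)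
    (huv : ∀ x ∈ Set.Icc (0 : ℝ) 1, |u x| ≤ |v x| + β) :
    ∫⁻ x in Set.Icc (0 : ℝ) 1, ENNReal.ofReal (Psi2 (|u x| / (A + 2 * β))) ≤ 1 := by
  set θ := A / (A + 2 * β) with hθ
  have hθ0 : 0 ≤ θ := by positivity
  have hθ1 : 0 ≤ 1 - θ := by
    rw [sub_nonneg, hθ, div_le_one (by positivity)]
    linarith
  have hhalf : Psi2 (1 / 2) ≤ 1 := by
    have h1 : (1 / 2 : ℝ) ^ 2 ≤ Real.log 2 := by linarith [Real.log_two_gt_d9]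
    have h2 := Real.exp_le_exp.2 h1
    rw [Real.exp_log two_pos] at h2
    simp only [Psi2]
    linarith
  have hpt : ∀ x ∈ Set.Icc (0 : ℝ) 1, ENNReal.ofReal (Psi2 (|u x| / (A + 2 * β))) ≤
      ENNReal.ofReal θ * ENNReal.ofReal (Psi2 (|v x| / A)) + ENNReal.ofReal (1 - θ) := by
    intro x hx
    have hP0 : 0 ≤ Psi2 (|v x| / A) := by
      simp only [Psi2, sub_nonneg]
      exact Real.one_le_exp (sq_nonneg _)
    rw [← ENNReal.ofReal_mul hθ0, ← ENNReal.ofReal_add (by positivity) hθ1]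
    refine ENNReal.ofReal_le_ofReal ?_
    calc Psi2 (|u x| / (A + 2 * β)) ≤ Psi2 (θ • (|v x| / A) + (1 - θ) • (1 / 2)) := by
          refine Psi2_le_Psi2 (by positivity) ?_
          have : θ • (|v x| / A) + (1 - θ) • (1 / 2) = (|v x| + β) / (A + 2 * β) := by
            simp only [hθ, smul_eq_mul]
            field_simp
            ring
          rw [this]
          gcongr
          exact huv x hx
      _ ≤ θ • Psi2 (|v x| / A) + (1 - θ) • Psi2 (1 / 2) :=
          convexOn_Psi2.2 trivial trivial hθ0 hθ1 (by ring)
      _ ≤ θ * Psi2 (|v x| / A) + (1 - θ) := by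
          simp only [smul_eq_mul]
          nlinarith
  calc _ ≤ ∫⁻ x in Set.Icc (0 : ℝ) 1,
        (ENNReal.ofReal θ * ENNReal.ofReal (Psi2 (|v x| / A)) + ENNReal.ofReal (1 - θ)) :=
        setLIntegral_mono' measurableSet_Icc hpt
    _ ≤ ENNReal.ofReal θ * 1 + ENNReal.ofReal (1 - θ) := by
        rw [lintegral_add_right _ measurable_const, lintegral_const_mul' _ _ ENNReal.ofReal_ne_top]
        simp only [lintegral_const, MeasurableSet.univ, Measure.restrict_apply, Set.univ_inter,
          Real.volume_Icc, sub_zero, ENNReal.ofReal_one, mul_one]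
        gcongr
        exact mul_le_of_le_one_right' hv
    _ = 1 := by
        rw [mul_one, ← ENNReal.ofReal_add hθ0 hθ1]
        simp

/-- For `h` between `(n+1)⁻⁵` and `n⁻⁵`, the constant that is admissible at `n⁻⁵`, corrected by the
Hölder bound for the distance `5 n⁻⁶` between the two grid points, exceeds `√(8/3) √h` only by
`O(h^r) √h`. The exponent `γ` is such that `n^(-6γ)` is `n^(-5r)` times `n^(-5/2)`. -/
theorem interpolated_constant_div_sqrt_le {r γ C h n : ℝ} (hr0 : 0 < r) (hr : r < 1 / 10)
    (hγ : γ = (5 / 2 + 5 * r) / 6) (hC : 0 ≤ C) (hn : 1 ≤ n)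
    (h1 : ((n + 1) ^ 5)⁻¹ ≤ h) :
    ((√(8 / 3) + ((n ^ 5)⁻¹) ^ r) * √((n ^ 5)⁻¹) + 2 * (C * (5 * (n ^ 6)⁻¹) ^ γ)) / √h ≤
      √(8 / 3) + (44 + 120 * C) * h ^ r := by
  have hn0 : 0 < n := by linarith
  have hh : 0 < h := lt_of_lt_of_le (by positivity) h1
  have hsh : 0 < √h := Real.sqrt_pos.2 hh
  have hinv : h⁻¹ ≤ (n + 1) ^ 5 := inv_le_of_inv_le₀ (by positivity) h1
  set w := ((n ^ 5)⁻¹) ^ r with hw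
  have hw0 : 0 < w := by positivity
  have hw1 : w ≤ 1 := Real.rpow_le_one (by positivity) (inv_le_one_of_one_le₀ (one_le_pow₀ hn)) hr0.le
  have hwn : w = n ^ (-(5 * r)) := by
    rw [hw, ← Real.rpow_natCast, ← Real.rpow_neg hn0.le, ← Real.rpow_mul hn0.le]
    congr 1
    push_cast
    ring
  have hn2 : (n + 1) ^ 5 ≤ 32 * n ^ 5 := by
    calc (n + 1) ^ 5 ≤ (2 * n) ^ 5 := by gcongr; linarith
      _ = 32 * n ^ 5 := by ring
  have hwh : w ≤ 2 * h ^ r := by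
    have h3 : (n ^ 5)⁻¹ ≤ 32 * h := by
      rw [inv_le_iff_one_le_mul₀ (by positivity)]
      have := (inv_le_iff_one_le_mul₀ hh).1 (hinv.trans hn2)
      linarith
    calc w ≤ (32 * h) ^ r := Real.rpow_le_rpow (by positivity) h3 hr0.le
      _ = 32 ^ r * h ^ r := Real.mul_rpow (by norm_num) hh.le
      _ ≤ 2 * h ^ r := by
        gcongr
        calc (32 : ℝ) ^ r ≤ 32 ^ (1 / 5 : ℝ) :=
              Real.rpow_le_rpow_of_exponent_le (by norm_num) (by linarith)
          _ = 2 := by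
              rw [show (32 : ℝ) = 2 ^ (5 : ℝ) by norm_num, ← Real.rpow_mul (by norm_num)]
              norm_num
  have hinvn : 1 / n ≤ w := by
    rw [hwn, one_div, ← Real.rpow_neg_one]
    exact Real.rpow_le_rpow_of_exponent_le hn (by linarith)
  have hratio : √((n ^ 5)⁻¹) / √h ≤ 1 + 7 / n := by
    rw [← Real.sqrt_div (by positivity)]
    refine Real.sqrt_le_iff.2 ⟨by positivity, ?_⟩
    have hu0 : 0 ≤ 1 / n := by positivity
    have hu1 : 1 / n ≤ 1 := (div_le_one hn0).2 hn
    calc (n ^ 5)⁻¹ / h ≤ (n ^ 5)⁻¹ * (n + 1) ^ 5 := by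
          rw [div_eq_mul_inv]
          gcongr
      _ = (1 + 1 / n) ^ 5 := by field_simp
      _ ≤ (1 + 1 / n) ^ 6 := pow_le_pow_right₀ (by linarith) (by norm_num)
      _ = ((1 + 1 / n) ^ 3) ^ 2 := by ring
      _ ≤ (1 + 7 / n) ^ 2 := by
          gcongr
          rw [show 7 / n = 7 * (1 / n) by ring]
          nlinarith [mul_nonneg hu0 (sub_nonneg.2 hu1), mul_nonneg (mul_nonneg hu0 hu0) (sub_nonneg.2 hu1)]
  have hholder : (5 * (n ^ 6)⁻¹) ^ γ / √h ≤ 30 * w := by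
    have e1 : (5 * (n ^ 6)⁻¹) ^ γ = 5 ^ γ * n ^ (-(6 * γ)) := by
      rw [Real.mul_rpow (by norm_num) (by positivity), ← Real.rpow_natCast, ← Real.rpow_neg hn0.le,
        ← Real.rpow_mul hn0.le]
      congr 2
      push_cast
      ring
    have e2 : (5 : ℝ) ^ γ ≤ 5 := by
      conv_rhs => rw [← Real.rpow_one 5]
      exact Real.rpow_le_rpow_of_exponent_le (by norm_num) (by linarith)
    have e3 : (√h)⁻¹ ≤ 6 * n ^ (5 / 2 : ℝ) := by
      rw [← Real.sqrt_inv]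
      refine Real.sqrt_le_iff.2 ⟨by positivity, ?_⟩
      have : (6 * n ^ (5 / 2 : ℝ)) ^ 2 = 36 * n ^ 5 := by
        rw [mul_pow, ← Real.rpow_natCast (n ^ (5 / 2 : ℝ)), ← Real.rpow_mul hn0.le]
        norm_num
      rw [this]
      exact hinv.trans (hn2.trans (by gcongr; norm_num))
    rw [div_eq_mul_inv, e1]
    calc 5 ^ γ * n ^ (-(6 * γ)) * (√h)⁻¹ ≤ 5 * n ^ (-(6 * γ)) * (6 * n ^ (5 / 2 : ℝ)) := by gcongr
      _ = 30 * (n ^ (-(6 * γ)) * n ^ (5 / 2 : ℝ)) := by ring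
      _ = 30 * w := by
          rw [← Real.rpow_add hn0, hwn, hγ]
          congr 2
          ring
  have h83 : √(8 / 3 : ℝ) ≤ 2 := Real.sqrt_le_iff.2 ⟨by norm_num, by norm_num⟩
  have h83' := Real.sqrt_nonneg (8 / 3 : ℝ)
  calc _ = (√(8 / 3) + w) * (√((n ^ 5)⁻¹) / √h) + 2 * C * ((5 * (n ^ 6)⁻¹) ^ γ / √h) := by ring
    _ ≤ (√(8 / 3) + w) * (1 + 7 / n) + 2 * C * (30 * w) := by gcongr
    _ ≤ √(8 / 3) + (22 + 60 * C) * w := by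
        have e : 7 / n ≤ 7 * w := by
          have : 7 / n = 7 * (1 / n) := by ring
          linarith
        nlinarith
    _ ≤ √(8 / 3) + (22 + 60 * C) * (2 * h ^ r) := by gcongr
    _ = _ := by ring

theorem inv_pow_sub_inv_succ_pow_le {n : ℝ} (hn : 1 ≤ n) :
    (n ^ 5)⁻¹ - ((n + 1) ^ 5)⁻¹ ≤ 5 * (n ^ 6)⁻¹ := by
  have hn0 : 0 < n := by linarith
  have h1 := one_add_mul_le_pow (a := -(1 / (n + 1))) (by
    have : 1 / (n + 1) ≤ 1 := (div_le_one (by positivity)).2 (by linarith)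
    linarith) 5
  have h2 : 1 / (n + 1) ≤ 1 / n := one_div_le_one_div_of_le hn0 (by linarith)
  have h3 : (1 + -(1 / (n + 1))) ^ 5 = n ^ 5 * ((n + 1) ^ 5)⁻¹ := by field_simp; ring
  push_cast at h1
  calc (n ^ 5)⁻¹ - ((n + 1) ^ 5)⁻¹ = (n ^ 5)⁻¹ * (1 - n ^ 5 * ((n + 1) ^ 5)⁻¹) := by field_simp
    _ ≤ (n ^ 5)⁻¹ * (5 * (1 / n)) := by
        gcongr
        linarith
    _ = 5 * (n ^ 6)⁻¹ := by field_simp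

/-- Borel-Cantelli along `n⁻⁵`: the constants `(√(8/3) + n^(-5r)) n^(-5/2)` are eventually
admissible. -/
theorem ae_eventually_lintegral_Psi2_le_one (hB : IsPreBrownianReal B P)
    (hBm : ∀ t, Measurable (B t)) (hBc : ∀ ω, Continuous fun t => B t ω)
    {r : ℝ} (hr0 : 0 < r) (hr : r < 1 / 10) :
    ∀ᵐ ω ∂P, ∀ᶠ n : ℕ in atTop, ∫⁻ x in Set.Icc (0 : ℝ) 1, ENNReal.ofReal
      (Psi2 (|B (x + ((n : ℝ) ^ 5)⁻¹).toNNReal ω - B x.toNNReal ω| /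
        ((√(8 / 3) + (((n : ℝ) ^ 5)⁻¹) ^ r) * √(((n : ℝ) ^ 5)⁻¹)))) ≤ 1 := by
  -- this range of `p`, nonempty for `r < 1/10`, makes `n ^ (-5 (p - 1 - r p))` summable
  obtain ⟨p, hp1, hp⟩ : ∃ p, 6 / (5 * (1 - r)) < p ∧ p < 4 / 3 := by
    refine exists_between ?_
    rw [div_lt_div_iff₀ (by linarith) (by norm_num)]
    linarith
  have hexp : 1 < 5 * (p - 1 - r * p) := by
    rw [div_lt_iff₀ (by linarith)] at hp1
    linarith
  obtain ⟨A, hA⟩ := exists_measure_one_lt_lintegral_Psi2_le hB hBm hBc hr0 (by nlinarith) hp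
  have hsum : Summable fun n : ℕ => A * (((n : ℝ) ^ 5)⁻¹) ^ (p - 1 - r * p) := by
    refine ((Real.summable_nat_rpow_inv.2 hexp).mul_left A).congr fun n => ?_
    rw [Real.inv_rpow (by positivity), ← Real.rpow_natCast (n : ℝ) 5, ← Real.rpow_mul (by positivity)]
    norm_num
  have hfin := ((summable_nat_add_iff 1).2 hsum).tsum_ofReal_ne_top
  have hbc := ae_eventually_notMem (μ := P) (s := fun k : ℕ =>
    {ω | 1 < ∫⁻ x in Set.Icc (0 : ℝ) 1, ENNReal.ofReal
      (Psi2 (|B (x + (((k + 1 : ℕ) : ℝ) ^ 5)⁻¹).toNNReal ω - B x.toNNReal ω| /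
        ((√(8 / 3) + ((((k + 1 : ℕ) : ℝ) ^ 5)⁻¹) ^ r) * √((((k + 1 : ℕ) : ℝ) ^ 5)⁻¹))))})
    (ne_top_of_le_ne_top hfin (ENNReal.tsum_le_tsum fun k =>
      hA _ (by positivity) (inv_le_one_of_one_le₀ (one_le_pow₀ (by simp)))))
  filter_upwards [hbc] with ω hω
  rw [← map_add_atTop_eq_nat 1, eventually_map]
  filter_upwards [hω] with k hk
  exact not_lt.1 hk

/-- The bound on the grid `n⁻⁵` extends to all small `h` by comparing `h` with the grid point given
by `n = ⌊h^(-1/5)⌋`. -/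
theorem isBigOAlmostSurely_modulusExcess {W : ℝ≥0 → Ω → ℝ} (hW : IsBrownianReal W P)
    {s : ℝ} (hs : s < 1 / 10) :
    IsBigOAlmostSurely P (modulusExcess W) (fun h => h ^ s) := by
  obtain ⟨B, hBm, hBc, hWB⟩ := exists_continuous_version hW
  have hB : IsPreBrownianReal B P := hW.congr fun t => hWB.mono fun ω hω => hω t
  obtain ⟨r, hr0, hr1⟩ := exists_between (max_lt hs (by norm_num : (0 : ℝ) < 1 / 10))
  obtain ⟨hsr, hr0⟩ := max_lt_iff.1 hr0
  set γ := (5 / 2 + 5 * r) / 6 with hγ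
  filter_upwards [hWB, ae_eventually_lintegral_Psi2_le_one hB hBm hBc hr0 hr1,
    ae_exists_holder_bound hB hBc (γ := γ) (by positivity) (by linarith)] with ω hω hgrid
    ⟨C, d₀, hC, hd₀, hhol⟩
  refine ⟨(44 + 120 * C).toNNReal, ?_⟩
  have hfloor : Tendsto (fun h : ℝ => ⌊h⁻¹ ^ (1 / 5 : ℝ)⌋₊) (𝓝[>] 0) atTop :=
    tendsto_nat_floor_atTop.comp
      ((tendsto_rpow_atTop (by norm_num : (0 : ℝ) < 1 / 5)).comp tendsto_inv_nhdsGT_zero)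
  have hd : ∀ᶠ n : ℕ in atTop, 5 * ((n : ℝ) ^ 6)⁻¹ ≤ d₀ := by
    have h1 : Tendsto (fun n : ℕ => 5 * ((n : ℝ) ^ 6)⁻¹) atTop (𝓝 (5 * 0)) :=
      (tendsto_inv_atTop_zero.comp ((tendsto_pow_atTop (by norm_num)).comp
        tendsto_natCast_atTop_atTop)).const_mul 5
    rw [mul_zero] at h1
    exact (h1.eventually (gt_mem_nhds hd₀)).mono fun n hn => le_of_lt hn
  filter_upwards [hfloor.eventually (hgrid.and (hd.and (eventually_ge_atTop 2))),
    Ioo_mem_nhdsGT (zero_lt_one (α := ℝ))] with h ⟨hn1, hnd, hn2⟩ ⟨hh, hh1⟩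
  set n := ⌊h⁻¹ ^ (1 / 5 : ℝ)⌋₊ with hn
  have hx0 : 0 ≤ h⁻¹ ^ (1 / 5 : ℝ) := by positivity
  have hx5 : (h⁻¹ ^ (1 / 5 : ℝ)) ^ 5 = h⁻¹ := by
    rw [← Real.rpow_natCast, ← Real.rpow_mul (by positivity)]
    norm_num
  have hn2' : (2 : ℝ) ≤ n := by exact_mod_cast hn2
  have hn0 : (0 : ℝ) < n := by linarith
  have hle1 : (((n : ℝ) + 1) ^ 5)⁻¹ ≤ h := by
    refine inv_le_of_inv_le₀ hh ?_
    rw [← hx5]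
    exact pow_le_pow_left₀ hx0 (Nat.lt_floor_add_one _).le 5
  have hle2 : h ≤ ((n : ℝ) ^ 5)⁻¹ := by
    refine le_inv_of_le_inv₀ (by positivity) ?_
    rw [← hx5]
    exact pow_le_pow_left₀ hn0.le (Nat.floor_le hx0) 5
  have hhn1 : ((n : ℝ) ^ 5)⁻¹ < 1 := inv_lt_one_of_one_lt₀ (one_lt_pow₀ (by linarith) (by norm_num))
  have hbound := interpolated_constant_div_sqrt_le hr0 hr1 hγ hC.le (by linarith) hle1
  have hint := lintegral_Psi2_le_one_of_abs_le (β := C * (5 * ((n : ℝ) ^ 6)⁻¹) ^ γ)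
    (u := fun x => B (x + h).toNNReal ω - B x.toNNReal ω) (by positivity) (by positivity) hn1
    (fun x hx => by
      have h1 := hhol (x + h).toNNReal (x + ((n : ℝ) ^ 5)⁻¹).toNNReal
        (Real.toNNReal_le_toNNReal (by linarith))
        (by
          rw [Real.toNNReal_lt_iff_lt_coe (by linarith [hx.1])]
          push_cast
          linarith [hx.2])
        (5 * ((n : ℝ) ^ 6)⁻¹) (by positivity) hnd (by
          rw [Real.coe_toNNReal _ (by linarith [hx.1]), Real.coe_toNNReal _ (by linarith [hx.1])]
          have := inv_pow_sub_inv_succ_pow_le (n := n) (by linarith)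
          linarith)
      rw [abs_sub_comm] at h1
      have h2 := abs_sub_le (B (x + h).toNNReal ω) (B (x + ((n : ℝ) ^ 5)⁻¹).toNNReal ω)
        (B x.toNNReal ω)
      linarith)
  simp_rw [← hω] at hint
  refine (modulusExcess_le_of_lintegral_le hh (by positivity) hbound hint).trans ?_
  rw [ENNReal.ofReal_mul (by positivity)]
  refine mul_le_mul' le_rfl (ENNReal.ofReal_le_ofReal ?_)
  exact Real.rpow_le_rpow_of_exponent_ge hh hh1.le hsr.le

end OrliczBrownian

theorem theorem3 {Ω : Type*} [MeasurableSpace Ω] (P : Measure Ω)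
    (W : ℝ≥0 → Ω → ℝ) (hW : IsBrownianReal W P) :
    (∀ s : ℝ, s < 1 / 4 →
      OrliczBrownian.IsBigOInProbability P (OrliczBrownian.modulusExcess W) (fun h => h ^ s)) ∧
    (∀ s' : ℝ, s' < 1 / 10 →
      OrliczBrownian.IsBigOAlmostSurely P (OrliczBrownian.modulusExcess W) (fun h => h ^ s')) :=
  ⟨fun _ hs => OrliczBrownian.isBigOInProbability_modulusExcess hW hs,
    fun _ hs => OrliczBrownian.isBigOAlmostSurely_modulusExcess hW hs⟩
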